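/- Let $q\colon\mathbb R\to[0,\infty)$ be a continuous, compactly supported probability density which is symmetric, $q(-x)=q(x)$ for all $x$. Consider the branching random walk on the infinite rooted ternary tree: every vertex $v$ has exactly three children, the edges carry i.i.d. random increments with density $q$, and $S_v$ is the sum of the increments along the path from the root $o$ to $v$ (so $S_o=0$). For $n\ge 0$ define values $\varphi_n(v)$ on the vertices of generation at most $n$ as follows: $\varphi_n(v)=S_v$ if $v$ is in generation $n$, and, recursively, if $v$ is in a generation less than $n$ then $\varphi_n(v)$ is the middle one (the median, i.e. the second in increasing order) of the three values of $\varphi_n$ at the children of $v$. Put $M_n:=\varphi_n(o)$. Then there is a set $I\subseteq\mathbb N$ such that the family of random variables $(M_n)_{n\in I}$ is tight and $$\liminf_{n\to\infty}\frac{|I\cap\{1,\dots,n\}|}{n}>0.$$ -/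

import Mathlib

open MeasureTheory ProbabilityTheory Filter

namespace TernaryVoting

/-- Vertices of the infinite rooted ternary tree: the root is `[]`, and the three children of `v`
are `i :: v` for `i : Fin 3`, so the generation of `v` is `v.length`. -/
abbrev Vertex : Type := List (Fin 3)

/-- Edges of the tree: `(v, i)` is the edge from `v` to its child `i :: v`. -/
abbrev Edge : Type := Vertex × Fin 3

/-- Position of the particle `v` when the walk starts at `0`: the sum of the increments `x` along
the edges of the path from the root to `v`. -/
noncomputable def position (x : Edge → ℝ) : Vertex → ℝ
  | [] => 0
  | i :: v => position x v + x (v, i)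

/-- The second of three values listed in increasing order. -/
noncomputable def middle (a : Fin 3 → ℝ) : ℝ := a (Tuple.sort a 1)

/-- `vote x m v` is the value assigned to the vertex `v` when the final generation is
`v.length + m`: a vertex of the final generation gets its position, and every other vertex gets
the middle one of the values of its three children. -/
noncomputable def vote (x : Edge → ℝ) : ℕ → Vertex → ℝ
  | 0, v => position x v
  | m + 1, v => middle fun i => vote x m (i :: v)

/-- The result of the vote at the root when the final generation is `n`. -/
noncomputable def result (x : Edge → ℝ) (n : ℕ) : ℝ := vote x n []

/-- A continuous, compactly supported probability density on the line. -/
structure IsJumpDensity (q : ℝ → ℝ) : Prop where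
  continuous : Continuous q
  hasCompactSupport : HasCompactSupport q
  nonneg : ∀ y, 0 ≤ q y
  integral_eq_one : ∫ y, q y = 1

/-- The increments `X e`, over the edges `e` of the tree, are independent random variables, each
with density `q`; the positions then form a branching random walk with ternary branching. -/
structure IsIncrementField {Ω : Type*} [MeasurableSpace Ω] (P : Measure Ω) (q : ℝ → ℝ)
    (X : Edge → Ω → ℝ) : Prop where
  measurable : ∀ e, Measurable (X e)
  indep : iIndepFun X P
  law : ∀ e, P.map (X e) = volume.withDensity fun y => ENNReal.ofReal (q y)

/-- The random variable `M n`, the result of the vote in the branching random walk. -/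
noncomputable def M {Ω : Type*} (X : Edge → Ω → ℝ) (n : ℕ) (ω : Ω) : ℝ := result (fun e => X e ω) n

/-- Lower asymptotic density of a set of natural numbers. -/
noncomputable def lowerDensity (I : Set ℕ) : ℝ :=
  liminf (fun n : ℕ => ((I ∩ Set.Icc 1 n).ncard : ℝ) / n) atTop

end TernaryVoting

namespace TernaryVoting

/-! ### The median of three numbers -/

/-! Write g for `majority`, G for its primitive, and `w n` for `wave μ n`. Three independent
children give the recursion `w (n+1) = μ * g(w n)`, and `M (n+1)` has distribution function `g(w
n)`. As g increases on [0,1], G is convex there. Tightness comes from an energy, `E n = ∫ (G*(g(w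
n)) - G(w (n+1)))`, with G* the Legendre transform. Convolution with a symmetric law is
self-adjoint, so the Fenchel-Young inequality makes `E n` nonincreasing (`energy_succ_le`). Jensen's
inequality bounds `E n` below by the integral of `potential (w n)` (`integral_potential_le_energy`),
and the potential is at least `s^3/2` on [0,1/2]. By symmetry and monotonicity, `w n` lies between
`w n (-A)` and 1/2 on [-A,0], hence `A * w n (-A)^3 / 2 ≤ E 0` for every n (`mul_wave_pow_le`). Both
tails are thus small uniformly in n, and I can be all positive integers. -/

theorem middle_le_iff (a : Fin 3 → ℝ) (t : ℝ) :
    middle a ≤ t ↔ (a 0 ≤ t ∧ a 1 ≤ t) ∨ (a 0 ≤ t ∧ a 2 ≤ t) ∨ (a 1 ≤ t ∧ a 2 ≤ t) := by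
  have hm := Tuple.monotone_sort a
  unfold middle
  generalize Tuple.sort a = σ at hm ⊢
  have h01 : a (σ 0) ≤ a (σ 1) := hm (by decide)
  have h12 : a (σ 1) ≤ a (σ 2) := hm (by decide)
  have key : ∀ σ : Equiv.Perm (Fin 3),
      (σ 0 = 0 ∧ σ 1 = 1 ∧ σ 2 = 2) ∨ (σ 0 = 0 ∧ σ 1 = 2 ∧ σ 2 = 1) ∨
      (σ 0 = 1 ∧ σ 1 = 0 ∧ σ 2 = 2) ∨ (σ 0 = 1 ∧ σ 1 = 2 ∧ σ 2 = 0) ∨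
      (σ 0 = 2 ∧ σ 1 = 0 ∧ σ 2 = 1) ∨ (σ 0 = 2 ∧ σ 1 = 1 ∧ σ 2 = 0) := by decide
  rcases key σ with ⟨h0, h1, h2⟩ | ⟨h0, h1, h2⟩ | ⟨h0, h1, h2⟩ | ⟨h0, h1, h2⟩ | ⟨h0, h1, h2⟩ |
    ⟨h0, h1, h2⟩ <;> rw [h0, h1] at h01 <;> rw [h1, h2] at h12 <;> rw [h1] <;> grind

theorem middle_const_add (c : ℝ) (a : Fin 3 → ℝ) :
    middle (fun i => c + a i) = c + middle a := by
  refine eq_of_forall_ge_iff fun t => ?_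
  rw [middle_le_iff, ← le_sub_iff_add_le' (b := middle a), middle_le_iff]
  simp only [le_sub_iff_add_le']

/-- The value of `vote x m v` relative to the position of `v`. -/
noncomputable def relVote (x : Edge → ℝ) : ℕ → Vertex → ℝ
  | 0, _ => 0
  | m + 1, v => middle fun i => x (v, i) + relVote x m (i :: v)

theorem vote_eq (x : Edge → ℝ) (m : ℕ) (v : Vertex) :
    vote x m v = position x v + relVote x m v := by
  induction m generalizing v with
  | zero => simp [vote, relVote]
  | succ m ih =>
    simp only [vote, relVote, ih, position, add_assoc]
    exact middle_const_add _ _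

theorem M_eq {Ω : Type*} (X : Edge → Ω → ℝ) (n : ℕ) (ω : Ω) :
    M X n ω = relVote (fun e => X e ω) n [] := by
  simp [M, result, vote_eq, position]

/-! ### Polynomials of the voting rule -/

/-- Probability that at least two of three independent events of probability `s` occur. -/
def majority (s : ℝ) : ℝ := 3 * s ^ 2 - 2 * s ^ 3

/-- The primitive of `majority` vanishing at `0`. -/
noncomputable def primitive (s : ℝ) : ℝ := s ^ 3 - s ^ 4 / 2

/-- The Legendre transform of `primitive`, at the slope `majority s`. -/
noncomputable def legendre (s : ℝ) : ℝ := s * majority s - primitive s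

theorem continuous_majority : Continuous majority := by unfold majority; fun_prop

theorem continuous_primitive : Continuous primitive := by unfold primitive; fun_prop

theorem continuous_legendre : Continuous legendre := by
  unfold legendre majority primitive; fun_prop

theorem majority_one_sub (s : ℝ) : majority (1 - s) = 1 - majority s := by
  unfold majority; ring

theorem majority_nonneg {s : ℝ} (h1 : s ≤ 1) : 0 ≤ majority s := by
  have : majority s = s ^ 2 * (3 - 2 * s) := by unfold majority; ring
  rw [this]
  exact mul_nonneg (sq_nonneg _) (by linarith)

theorem majority_le_one {s : ℝ} (h0 : 0 ≤ s) : majority s ≤ 1 := by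
  have := majority_nonneg (s := 1 - s) (by linarith)
  rw [majority_one_sub] at this
  linarith

theorem majority_le {s : ℝ} (h0 : 0 ≤ s) (h1 : s ≤ 1 / 2) : majority s ≤ s := by
  have : s - majority s = s * ((1 - s) * (1 - 2 * s)) := by unfold majority; ring
  have := mul_nonneg h0 (mul_nonneg (by linarith : 0 ≤ 1 - s) (by linarith : 0 ≤ 1 - 2 * s))
  linarith

theorem majority_le_majority {a b : ℝ} (h0 : 0 ≤ a) (hab : a ≤ b) (h1 : b ≤ 1) :
    majority a ≤ majority b := by
  have h : majority b - majority a =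
      (b - a) * (3 * a * (1 - a) + 3 * b * (1 - b) + (b - a) ^ 2) := by
    unfold majority; ring
  have h2 := mul_nonneg h0 (sub_nonneg.2 (hab.trans h1))
  have h3 := mul_nonneg (h0.trans hab) (sub_nonneg.2 h1)
  have := mul_nonneg (sub_nonneg.2 hab)
    (by nlinarith [sq_nonneg (b - a)] : 0 ≤ 3 * a * (1 - a) + 3 * b * (1 - b) + (b - a) ^ 2)
  linarith

/-- Convexity of G on [0,1]. Rearranged, it is the Fenchel-Young inequality behind the energy decay;
it also yields Jensen's inequality. -/
theorem primitive_tangent_le {a b : ℝ} (ha0 : 0 ≤ a) (ha1 : a ≤ 1) (hb0 : 0 ≤ b) (hb1 : b ≤ 1) :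
    primitive a + majority a * (b - a) ≤ primitive b := by
  have h : primitive b - (primitive a + majority a * (b - a)) =
      (b - a) ^ 2 * (b + 2 * a - (b ^ 2 + 2 * a * b + 3 * a ^ 2) / 2) := by
    unfold primitive majority; ring
  -- Add `b^2 ≤ b`, `2ab ≤ a + b` and `3a^2 ≤ 3a`.
  have h2 : 0 ≤ b + 2 * a - (b ^ 2 + 2 * a * b + 3 * a ^ 2) / 2 := by
    nlinarith [mul_nonneg ha0 (sub_nonneg.2 ha1), mul_nonneg hb0 (sub_nonneg.2 hb1),
      mul_nonneg ha0 (sub_nonneg.2 hb1), mul_nonneg hb0 (sub_nonneg.2 ha1)]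
  have := mul_nonneg (sq_nonneg (b - a)) h2
  linarith

theorem primitive_le_primitive {a b : ℝ} (h0 : 0 ≤ a) (hab : a ≤ b) (h1 : b ≤ 1) :
    primitive a ≤ primitive b := by
  have := primitive_tangent_le h0 (hab.trans h1) (h0.trans hab) h1
  have := mul_nonneg (majority_nonneg (hab.trans h1)) (sub_nonneg.2 hab)
  linarith

/-- The potential of the energy: it vanishes at `0` and `1` and is positive in between. -/
noncomputable def potential (s : ℝ) : ℝ := legendre s - primitive (majority s)

theorem potential_one_sub (s : ℝ) : potential (1 - s) = potential s := by
  unfold potential legendre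
  rw [majority_one_sub]
  unfold primitive majority; ring

/-- Below 1/2 the vote lowers s, so `G(g(s)) ≤ G(s)`, and `legendre s - G(s) = s^3 (1 - s)`. -/
theorem cube_le_potential {s : ℝ} (h0 : 0 ≤ s) (h1 : s ≤ 1 / 2) : s ^ 3 / 2 ≤ potential s := by
  have h2 := primitive_le_primitive (majority_nonneg (by linarith)) (majority_le h0 h1)
    (by linarith)
  have h3 : legendre s - primitive s - s ^ 3 / 2 = s ^ 3 * (1 / 2 - s) := by
    unfold legendre majority primitive; ring
  have h4 := mul_nonneg (pow_nonneg h0 3) (sub_nonneg.2 h1)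
  unfold potential; linarith

theorem potential_nonneg {s : ℝ} (h0 : 0 ≤ s) (h1 : s ≤ 1) : 0 ≤ potential s := by
  rcases le_total s (1 / 2) with h | h
  · exact (by positivity : (0 : ℝ) ≤ s ^ 3 / 2).trans (cube_le_potential h0 h)
  · rw [← potential_one_sub]
    have h' : 0 ≤ 1 - s := by linarith
    exact (by positivity : (0 : ℝ) ≤ (1 - s) ^ 3 / 2).trans (cube_le_potential h' (by linarith))

/-! ### Functions that are constant near both ends of the line -/

/-- A bounded measurable function equal to `c` near `-∞` and to `d` near `∞`. -/
structure IsConstAtEnds (f : ℝ → ℝ) (c d : ℝ) : Prop where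
  measurable : Measurable f
  bounded : ∃ B, ∀ x, |f x| ≤ B
  ends : ∃ A, (∀ x ≤ -A, f x = c) ∧ ∀ x, A ≤ x → f x = d

namespace IsConstAtEnds

variable {f h : ℝ → ℝ} {c d c' d' : ℝ}

theorem const (c : ℝ) : IsConstAtEnds (fun _ => c) c c :=
  ⟨measurable_const, ⟨|c|, fun _ => le_rfl⟩, 0, fun _ _ => rfl, fun _ _ => rfl⟩

theorem comp (hf : IsConstAtEnds f c d) {φ : ℝ → ℝ} (hφ : Continuous φ) :
    IsConstAtEnds (fun x => φ (f x)) (φ c) (φ d) := by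
  refine ⟨hφ.measurable.comp hf.measurable, ?_, ?_⟩
  · obtain ⟨B, hB⟩ := hf.bounded
    obtain ⟨C, hC⟩ := (isCompact_Icc (a := -B) (b := B)).exists_bound_of_continuousOn
      hφ.continuousOn
    exact ⟨C, fun x => hC _ (abs_le.1 (hB x))⟩
  · obtain ⟨A, h1, h2⟩ := hf.ends
    exact ⟨A, fun x hx => by rw [h1 x hx], fun x hx => by rw [h2 x hx]⟩

theorem sub (hf : IsConstAtEnds f c d) (hh : IsConstAtEnds h c' d') :
    IsConstAtEnds (fun x => f x - h x) (c - c') (d - d') := by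
  obtain ⟨B, hB⟩ := hf.bounded
  obtain ⟨B', hB'⟩ := hh.bounded
  obtain ⟨A, h1, h2⟩ := hf.ends
  obtain ⟨A', h1', h2'⟩ := hh.ends
  refine ⟨hf.measurable.sub hh.measurable,
    ⟨B + B', fun x => (abs_sub _ _).trans (add_le_add (hB x) (hB' x))⟩, max A A',
    fun x hx => ?_, fun x hx => ?_⟩
  · rw [h1 x (by linarith [le_max_left A A']), h1' x (by linarith [le_max_right A A'])]
  · rw [h2 x (by linarith [le_max_left A A']), h2' x (by linarith [le_max_right A A'])]

theorem mul (hf : IsConstAtEnds f c d) (hh : IsConstAtEnds h c' d') :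
    IsConstAtEnds (fun x => f x * h x) (c * c') (d * d') := by
  obtain ⟨B, hB⟩ := hf.bounded
  obtain ⟨B', hB'⟩ := hh.bounded
  obtain ⟨A, h1, h2⟩ := hf.ends
  obtain ⟨A', h1', h2'⟩ := hh.ends
  refine ⟨hf.measurable.mul hh.measurable, ⟨B * B', fun x => ?_⟩, max A A',
    fun x hx => ?_, fun x hx => ?_⟩
  · rw [abs_mul]
    exact mul_le_mul (hB x) (hB' x) (abs_nonneg _) ((abs_nonneg _).trans (hB x))
  · rw [h1 x (by linarith [le_max_left A A']), h1' x (by linarith [le_max_right A A'])]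
  · rw [h2 x (by linarith [le_max_left A A']), h2' x (by linarith [le_max_right A A'])]

theorem integrable (hf : IsConstAtEnds f c d) (hc : c = 0) (hd : d = 0) : Integrable f := by
  obtain ⟨B, hB⟩ := hf.bounded
  obtain ⟨A, h1, h2⟩ := hf.ends
  have hs : Function.support f ⊆ Set.Icc (-A) A := fun x hx => by
    by_contra hx'
    rw [Set.mem_Icc, not_and_or, not_le, not_le] at hx'
    rcases hx' with hx' | hx'
    · exact hx (by rw [h1 x hx'.le, hc])
    · exact hx (by rw [h2 x hx'.le, hd])
  rw [← integrableOn_iff_integrable_of_support_subset hs]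
  exact Measure.integrableOn_of_bounded (M := B) (by simp) hf.measurable.aestronglyMeasurable
    (ae_of_all _ hB)

end IsConstAtEnds

/-! ### Averaging over the jump law -/

/-- The convolution of a function with the jump law `μ`. -/
noncomputable def smear (μ : Measure ℝ) (f : ℝ → ℝ) (x : ℝ) : ℝ := ∫ y, f (x - y) ∂μ

section Smear

theorem smear_nonneg {μ : Measure ℝ} {f : ℝ → ℝ} (hf : ∀ x, 0 ≤ f x) (x : ℝ) : 0 ≤ smear μ f x :=
  integral_nonneg fun _ => hf _

variable {μ : Measure ℝ} [IsProbabilityMeasure μ] {f h : ℝ → ℝ} {c d c' d' R : ℝ}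

theorem integrable_translate (hf : Measurable f) (hb : ∃ B, ∀ x, |f x| ≤ B) (x : ℝ) :
    Integrable (fun y => f (x - y)) μ := by
  obtain ⟨B, hB⟩ := hb
  exact Integrable.of_bound (hf.comp (measurable_const.sub measurable_id)).aestronglyMeasurable B
    (ae_of_all _ fun y => hB _)

theorem measurable_smear (hf : Measurable f) : Measurable (smear μ f) := by
  have : Measurable (Function.uncurry fun x y : ℝ => f (x - y)) := hf.comp measurable_sub
  exact this.stronglyMeasurable.integral_prod_right.measurable

theorem smear_mono (hf : IsConstAtEnds f c d) (hh : IsConstAtEnds h c' d') (x y : ℝ)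
    (hxy : ∀ z, f (x - z) ≤ h (y - z)) : smear μ f x ≤ smear μ h y :=
  integral_mono (integrable_translate hf.measurable hf.bounded x)
    (integrable_translate hh.measurable hh.bounded y) hxy

theorem smear_const (c x : ℝ) : smear μ (fun _ => c) x = c := by simp [smear]

theorem IsConstAtEnds.smear (hf : IsConstAtEnds f c d) (hR : ∀ᵐ y ∂μ, |y| ≤ R) :
    IsConstAtEnds (smear μ f) c d := by
  refine ⟨measurable_smear hf.measurable, ?_, ?_⟩
  · obtain ⟨B, hB⟩ := hf.bounded
    exact ⟨B, fun x => by
      have h := norm_integral_le_of_norm_le_const (μ := μ) (f := fun y => f (x - y))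
        (ae_of_all _ fun y => hB (x - y))
      simpa [TernaryVoting.smear] using h⟩
  · obtain ⟨A, h1, h2⟩ := hf.ends
    refine ⟨A + R, fun x hx => ?_, fun x hx => ?_⟩
    · have : ∀ᵐ y ∂μ, f (x - y) = c := by
        filter_upwards [hR] with y hy
        exact h1 _ (by linarith [(abs_le.1 hy).1])
      simp [TernaryVoting.smear, integral_congr_ae this]
    · have : ∀ᵐ y ∂μ, f (x - y) = d := by
        filter_upwards [hR] with y hy
        exact h2 _ (by linarith [(abs_le.1 hy).2])
      simp [TernaryVoting.smear, integral_congr_ae this]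

/-- Averaging over a symmetric jump law is formally self-adjoint. -/
theorem integral_smear_mul_sub_mul_smear [μ.IsNegInvariant] (hf : IsConstAtEnds f c d)
    (hh : IsConstAtEnds h c' d') (hR : ∀ᵐ y ∂μ, |y| ≤ R) :
    ∫ x, (smear μ f x * h x - f x * smear μ h x) = 0 := by
  obtain ⟨B, hB⟩ := hf.bounded
  obtain ⟨B', hB'⟩ := hh.bounded
  obtain ⟨A, h1, h2⟩ := hf.ends
  obtain ⟨A', h1', h2'⟩ := hh.ends
  let k : ℝ → ℝ → ℝ := fun x y => f (x - y) * h x - f x * h (x - y)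
  have hB0 : 0 ≤ B := (abs_nonneg _).trans (hB 0)
  have hk : Integrable (Function.uncurry k) (volume.prod μ) := by
    have hm : Measurable (Function.uncurry k) :=
      ((hf.measurable.comp measurable_sub).mul (hh.measurable.comp measurable_fst)).sub
        ((hf.measurable.comp measurable_fst).mul (hh.measurable.comp measurable_sub))
    -- A jump moves a point by at most R, so for x outside [-r, r] both x and x - y lie in the same
    -- constant end, where the two products in k cancel.
    set r := max A A' + |R| with hr
    have hon : IntegrableOn (Function.uncurry k) (Set.Icc (-r) r ×ˢ Set.univ)
        (volume.prod μ) := by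
      refine Measure.integrableOn_of_bounded (M := B * B' + B * B') ?_
        hm.aestronglyMeasurable (ae_of_all _ ?_)
      · rw [Measure.prod_prod]
        simp
      · rintro ⟨x, y⟩
        refine (abs_sub _ _).trans (add_le_add ?_ ?_) <;> rw [abs_mul]
        · exact mul_le_mul (hB _) (hB' _) (abs_nonneg _) hB0
        · exact mul_le_mul (hB _) (hB' _) (abs_nonneg _) hB0
    refine hon.integrable_of_ae_notMem_eq_zero ?_
    have hR' : ∀ᵐ z ∂(volume : Measure ℝ).prod μ, |z.2| ≤ R :=
      Measure.quasiMeasurePreserving_snd.ae hR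
    filter_upwards [hR'] with z hz hzr
    obtain ⟨x, y⟩ := z
    have hy := abs_le.1 (hz.trans (le_abs_self R))
    have hR0 := abs_nonneg R
    have hA := le_max_left A A'
    have hA' := le_max_right A A'
    simp only [Set.mem_prod, Set.mem_Icc, Set.mem_univ, and_true, not_and_or, not_le] at hzr hy
    change f (x - y) * h x - f x * h (x - y) = 0
    rcases hzr with hx | hx
    · rw [h1 x (by linarith), h1' x (by linarith), h1 (x - y) (by linarith),
        h1' (x - y) (by linarith), sub_self]
    · rw [h2 x (by linarith), h2' x (by linarith), h2 (x - y) (by linarith),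
        h2' (x - y) (by linarith), sub_self]
  have hswap : ∫ x, (smear μ f x * h x - f x * smear μ h x) = ∫ y, (∫ x, k x y) ∂μ := by
    rw [← integral_integral_swap hk]
    congr 1 with x
    have i1 := integrable_translate (μ := μ) hf.measurable hf.bounded x
    have i2 := integrable_translate (μ := μ) hh.measurable hh.bounded x
    rw [integral_sub (i1.mul_const _) (i2.const_mul _), integral_mul_const, integral_const_mul]
    rfl
  -- Translating x by y exchanges the two products in k. The inner integral is therefore odd in y,
  -- and a symmetric law integrates it to zero.
  have hodd : ∀ y, ∫ x, k x (-y) = -∫ x, k x y := fun y => by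
    rw [← integral_neg, ← integral_sub_right_eq_self _ y]
    congr 1 with x
    simp only [k, sub_neg_eq_add, sub_add_cancel]
    ring
  have hneg := integral_neg_eq_self (fun y => ∫ x, k x y) μ
  simp only [hodd, integral_neg] at hneg
  rw [hswap]
  linarith

theorem integral_smear_sub [μ.IsNegInvariant] (hf : IsConstAtEnds f c d)
    (hR : ∀ᵐ y ∂μ, |y| ≤ R) : ∫ x, (smear μ f x - f x) = 0 := by
  simpa [smear_const] using integral_smear_mul_sub_mul_smear hf (IsConstAtEnds.const 1) hR

/-- Jensen's inequality for the convex function `primitive`. -/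
theorem primitive_smear_le (hf : IsConstAtEnds f c d) (h0 : ∀ x, 0 ≤ f x) (h1 : ∀ x, f x ≤ 1)
    (x : ℝ) : primitive (smear μ f x) ≤ smear μ (fun z => primitive (f z)) x := by
  have hc := hf.comp continuous_primitive
  have i1 := integrable_translate (μ := μ) hf.measurable hf.bounded x
  have i2 := integrable_translate (μ := μ) hc.measurable hc.bounded x
  have ha0 : 0 ≤ smear μ f x := smear_nonneg h0 x
  have ha1 : smear μ f x ≤ 1 :=
    (smear_mono hf (IsConstAtEnds.const 1) x x fun z => h1 _).trans_eq (smear_const 1 x)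
  set a := smear μ f x with ha
  have key : ∫ y, (primitive a + majority a * (f (x - y) - a)) ∂μ ≤
      ∫ y, primitive (f (x - y)) ∂μ := by
    refine integral_mono ?_ i2 fun y => primitive_tangent_le ha0 ha1 (h0 _) (h1 _)
    exact (integrable_const _).add ((i1.sub (integrable_const _)).const_mul _)
  have hi : Integrable (fun y => majority a * (f (x - y) - a)) μ :=
    (i1.sub (integrable_const _)).const_mul _
  rw [integral_add (integrable_const _) hi,
    integral_const_mul, integral_sub i1 (integrable_const _)] at key
  have hint : ∫ y, f (x - y) ∂μ = a := rfl
  simpa [hint, smear] using key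

end Smear

/-! ### The wave -/

/-- `wave μ n` is the distribution function of the value of a child of a vertex `n + 1`
generations above the final one, relative to the position of that vertex. -/
noncomputable def wave (μ : Measure ℝ) : ℕ → ℝ → ℝ
  | 0 => smear μ ((Set.Ici 0).indicator 1)
  | n + 1 => smear μ fun x => majority (wave μ n x)

section Wave

variable {μ : Measure ℝ} [IsProbabilityMeasure μ] {R : ℝ}

theorem isConstAtEnds_heaviside : IsConstAtEnds ((Set.Ici (0 : ℝ)).indicator 1) 0 1 := by
  refine ⟨measurable_one.indicator measurableSet_Ici, ⟨1, fun x => ?_⟩, 1, fun x hx => ?_,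
    fun x hx => ?_⟩
  · by_cases hx : x ∈ Set.Ici (0 : ℝ) <;> simp [hx]
  · exact Set.indicator_of_notMem (by simp; linarith) _
  · exact Set.indicator_of_mem (by simp; linarith) _

theorem isConstAtEnds_wave (hR : ∀ᵐ y ∂μ, |y| ≤ R) (n : ℕ) : IsConstAtEnds (wave μ n) 0 1 := by
  induction n with
  | zero => exact isConstAtEnds_heaviside.smear hR
  | succ n ih => 
    have h := (ih.comp continuous_majority).smear hR
    rwa [show majority 0 = 0 by norm_num [majority], show majority 1 = 1 by norm_num [majority]] at h

theorem wave_mem_Icc (hR : ∀ᵐ y ∂μ, |y| ≤ R) (n : ℕ) (x : ℝ) :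
    0 ≤ wave μ n x ∧ wave μ n x ≤ 1 := by
  induction n generalizing x with
  | zero =>
    refine ⟨smear_nonneg (fun x => Set.indicator_nonneg (fun _ _ => zero_le_one) x) x, ?_⟩
    refine (smear_mono isConstAtEnds_heaviside (IsConstAtEnds.const 1) x x fun z => ?_).trans_eq
      (smear_const 1 x)
    exact Set.indicator_le_self' (fun _ _ => zero_le_one) _
  | succ n ih =>
    refine ⟨smear_nonneg (fun x => majority_nonneg (ih x).2) x, ?_⟩
    exact (smear_mono ((isConstAtEnds_wave hR n).comp continuous_majority)
      (IsConstAtEnds.const 1) x x fun z => majority_le_one (ih _).1).trans_eq (smear_const 1 x)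

theorem monotone_wave (hR : ∀ᵐ y ∂μ, |y| ≤ R) (n : ℕ) : Monotone (wave μ n) := by
  intro x y hxy
  induction n generalizing x y with
  | zero =>
    refine smear_mono isConstAtEnds_heaviside isConstAtEnds_heaviside x y fun z => ?_
    by_cases hx : 0 ≤ x - z
    · have hy : 0 ≤ y - z := by linarith
      simp [Set.indicator, sub_nonneg.1 hx, sub_nonneg.1 hy]
    · rw [Set.indicator_of_notMem (by simpa using hx)]
      exact Set.indicator_nonneg (fun _ _ => zero_le_one) _
  | succ n ih =>
    have h := (isConstAtEnds_wave hR n).comp continuous_majority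
    refine smear_mono h h x y fun z => ?_
    exact majority_le_majority (wave_mem_Icc hR n _).1 (ih (by linarith)) (wave_mem_Icc hR n _).2

/-- Both the jump law and the majority rule are symmetric, so the recursion preserves the
reflection. -/
theorem wave_neg [μ.IsNegInvariant] [NullSingletonClass μ] (hR : ∀ᵐ y ∂μ, |y| ≤ R) (n : ℕ) (x : ℝ) :
    wave μ n (-x) = 1 - wave μ n x := by
  have hsub {f : ℝ → ℝ} {c d : ℝ} (hf : IsConstAtEnds f c d) (x : ℝ) :
      1 - smear μ f x = ∫ y, (1 - f (x - y)) ∂μ := by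
    rw [integral_sub (integrable_const _) (integrable_translate hf.measurable hf.bounded x)]
    simp [smear]
  have hrefl (f : ℝ → ℝ) (x : ℝ) : smear μ f (-x) = ∫ y, f (-(x - y)) ∂μ := by
    rw [smear, ← integral_neg_eq_self _ μ]
    congr 1 with y
    congr 1
    ring
  induction n generalizing x with
  | zero =>
    rw [wave, hsub isConstAtEnds_heaviside, hrefl]
    refine integral_congr_ae ?_
    -- The Heaviside function breaks the symmetry only at its jump, which a law without atoms
    -- ignores.
    filter_upwards [Measure.ae_ne μ x] with y hy
    rcases lt_or_gt_of_ne hy with hy | hy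
    · simp [Set.indicator, hy.le, hy.not_ge]
    · simp [Set.indicator, hy.le, hy.not_ge]
  | succ n ih =>
    rw [wave, hsub ((isConstAtEnds_wave hR n).comp continuous_majority), hrefl]
    congr 1 with y
    rw [ih, majority_one_sub]

/-- The energy of the pair of consecutive waves. -/
noncomputable def energy (μ : Measure ℝ) (n : ℕ) : ℝ :=
  ∫ x, (legendre (wave μ n x) - primitive (wave μ (n + 1) x))

/-- Each term equals 1/2 near +∞; only their difference is integrable. -/
theorem integrable_energy (hR : ∀ᵐ y ∂μ, |y| ≤ R) (n : ℕ) :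
    Integrable fun x => legendre (wave μ n x) - primitive (wave μ (n + 1) x) :=
  (((isConstAtEnds_wave hR n).comp continuous_legendre).sub
    ((isConstAtEnds_wave hR (n + 1)).comp continuous_primitive)).integrable
    (by norm_num [legendre, primitive, majority]) (by norm_num [legendre, primitive, majority])

/-- Self-adjointness replaces `∫ w (n+1) g(w (n+1))` by `∫ g(w n) w (n+2)`, up to a difference of
zero integral. What remains is the tangent inequality for G between `w n` and `w (n+2)`, pointwise.
-/
theorem energy_succ_le [μ.IsNegInvariant] (hR : ∀ᵐ y ∂μ, |y| ≤ R) (n : ℕ) :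
    energy μ (n + 1) ≤ energy μ n := by
  have hw := fun n => isConstAtEnds_wave hR n
  have hu := fun n => (hw n).comp continuous_majority
  have hadj : ∫ x, (wave μ (n + 1) x * majority (wave μ (n + 1) x) -
      majority (wave μ n x) * wave μ (n + 2) x) = 0 :=
    integral_smear_mul_sub_mul_smear (hu n) (hu (n + 1)) hR
  have hint : Integrable fun x => wave μ (n + 1) x * majority (wave μ (n + 1) x) -
      majority (wave μ n x) * wave μ (n + 2) x :=
    (((hw (n + 1)).mul (hu (n + 1))).sub ((hu n).mul (hw (n + 2)))).integrable
      (by norm_num [majority]) (by norm_num [majority])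
  have hle : energy μ (n + 1) - ∫ x, (wave μ (n + 1) x * majority (wave μ (n + 1) x) -
      majority (wave μ n x) * wave μ (n + 2) x) ≤ energy μ n := by
    unfold energy
    rw [← integral_sub (integrable_energy hR (n + 1)) hint]
    refine integral_mono ((integrable_energy hR (n + 1)).sub hint) (integrable_energy hR n)
      fun x => ?_
    have := primitive_tangent_le (wave_mem_Icc hR n x).1 (wave_mem_Icc hR n x).2
      (wave_mem_Icc hR (n + 2) x).1 (wave_mem_Icc hR (n + 2) x).2
    simp only [legendre]
    linarith
  linarith

theorem integrable_potential (hR : ∀ᵐ y ∂μ, |y| ≤ R) (n : ℕ) :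
    Integrable fun x => potential (wave μ n x) :=
  ((isConstAtEnds_wave hR n).comp (continuous_legendre.sub
    (continuous_primitive.comp continuous_majority))).integrable
    (by norm_num [legendre, primitive, majority]) (by norm_num [legendre, primitive, majority])

/-- Jensen gives `G(w (n+1)) ≤ μ * G(g(w n))`, and convolution with μ does not change the integral.
-/
theorem integral_potential_le_energy [μ.IsNegInvariant] (hR : ∀ᵐ y ∂μ, |y| ≤ R) (n : ℕ) :
    ∫ x, potential (wave μ n x) ≤ energy μ n := by
  have hu := (isConstAtEnds_wave hR n).comp continuous_majority
  have hp := hu.comp continuous_primitive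
  have hint : Integrable fun x => smear μ (fun z => primitive (majority (wave μ n z))) x -
      primitive (majority (wave μ n x)) :=
    ((hp.smear hR).sub hp).integrable (by norm_num) (by norm_num)
  have h0 := integral_smear_sub hp hR
  have hle : (∫ x, potential (wave μ n x)) -
      ∫ x, (smear μ (fun z => primitive (majority (wave μ n z))) x -
        primitive (majority (wave μ n x))) ≤ energy μ n := by
    unfold energy
    rw [← integral_sub (integrable_potential hR n) hint]
    refine integral_mono ((integrable_potential hR n).sub hint) (integrable_energy hR n)
      fun x => ?_
    have : primitive (wave μ (n + 1) x) ≤ _ := primitive_smear_le (μ := μ) hu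
      (fun x => majority_nonneg (wave_mem_Icc hR n x).2)
      (fun x => majority_le_one (wave_mem_Icc hR n x).1) x
    simp only [potential]
    linarith
  linarith

theorem integral_potential_le [μ.IsNegInvariant] (hR : ∀ᵐ y ∂μ, |y| ≤ R) (n : ℕ) :
    ∫ x, potential (wave μ n x) ≤ energy μ 0 :=
  (integral_potential_le_energy hR n).trans
    (antitone_nat_of_succ_le (energy_succ_le hR) (Nat.zero_le n))

/-- The lower tails of the waves decay uniformly. -/
theorem mul_wave_pow_le [μ.IsNegInvariant] [NullSingletonClass μ] (hR : ∀ᵐ y ∂μ, |y| ≤ R) (n : ℕ) {A : ℝ}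
    (hA : 0 ≤ A) : A * (wave μ n (-A) ^ 3 / 2) ≤ energy μ 0 := by
  have hhalf : wave μ n 0 = 1 / 2 := by
    have := wave_neg (μ := μ) hR n 0
    rw [neg_zero] at this
    linarith
  have hint := integrable_potential (μ := μ) hR n
  have h1 : ∫ x in Set.Icc (-A) 0, wave μ n (-A) ^ 3 / 2 ≤
      ∫ x in Set.Icc (-A) 0, potential (wave μ n x) := by
    refine setIntegral_mono_on (integrableOn_const (by simp)) hint.integrableOn
      measurableSet_Icc fun x hx => ?_
    have hm := monotone_wave hR n hx.1
    refine le_trans ?_ (cube_le_potential (wave_mem_Icc hR n x).1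
      ((monotone_wave hR n hx.2).trans_eq hhalf))
    have := pow_le_pow_left₀ (wave_mem_Icc hR n (-A)).1 hm 3
    linarith
  have h2 := setIntegral_le_integral (s := Set.Icc (-A) 0) hint
    (ae_of_all _ fun x => potential_nonneg (wave_mem_Icc hR n x).1 (wave_mem_Icc hR n x).2)
  have h3 := integral_potential_le (μ := μ) hR n
  rw [setIntegral_const] at h1
  simp only [Measure.real, Real.volume_Icc, sub_neg_eq_add, zero_add, ENNReal.toReal_ofReal hA,
    smul_eq_mul] at h1
  linarith

end Wave

/-! ### The law of the vote -/

/-- The edges below the vertex `v`. -/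
def edgesBelow (v : Vertex) : Set Edge := {e | v <:+ e.1}

/-- The edges of the branch of `v` that starts with the edge from `v` to its child `i :: v`. -/
def branch (v : Vertex) (i : Fin 3) : Set Edge := insert (v, i) (edgesBelow (i :: v))

theorem branch_subset (v : Vertex) (i : Fin 3) : branch v i ⊆ edgesBelow v := by
  rintro e (rfl | he)
  · exact List.suffix_rfl
  · exact (List.suffix_cons i v).trans he

theorem notMem_edgesBelow_cons (v : Vertex) (i j : Fin 3) : (v, j) ∉ edgesBelow (i :: v) :=
  fun h => by simpa using List.IsSuffix.length_le h

theorem disjoint_branch (v : Vertex) {i j : Fin 3} (hij : i ≠ j) :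
    Disjoint (branch v i) (branch v j) := by
  rw [Set.disjoint_left]
  rintro e (rfl | hi) (hj | hj)
  · exact hij (Prod.ext_iff.1 hj).2
  · exact notMem_edgesBelow_cons v j i hj
  · exact notMem_edgesBelow_cons v i j (hj ▸ hi)
  -- Two suffixes of one list having equal length coincide.
  · have := (List.suffix_of_suffix_length_le hi hj (by simp)).eq_of_length (by simp)
    exact hij (List.cons.inj this).1

/-- The σ-algebra generated by the increments along the edges in `S`. -/
abbrev sigmaEdges {Ω : Type*} (X : Edge → Ω → ℝ) (S : Set Edge) : MeasurableSpace Ω :=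
  ⨆ e ∈ S, MeasurableSpace.comap (X e) inferInstance

theorem sigmaEdges_mono {Ω : Type*} {X : Edge → Ω → ℝ} {S T : Set Edge} (h : S ⊆ T) :
    sigmaEdges X S ≤ sigmaEdges X T :=
  biSup_mono h

theorem measurable_increment {Ω : Type*} {X : Edge → Ω → ℝ} {S : Set Edge} {e : Edge}
    (he : e ∈ S) : Measurable[sigmaEdges X S] (X e) :=
  (comap_measurable (X e)).mono
    (le_biSup (fun e => MeasurableSpace.comap (X e) inferInstance) he) le_rfl

theorem measurable_middle {Ω : Type*} [MeasurableSpace Ω] {Z : Fin 3 → Ω → ℝ}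
    (hZ : ∀ i, Measurable (Z i)) : Measurable fun ω => middle fun i => Z i ω := by
  refine measurable_of_Iic fun t => ?_
  have h : ∀ i, MeasurableSet {ω | Z i ω ≤ t} := fun i => measurableSet_le (hZ i) measurable_const
  have : (fun ω => middle fun i => Z i ω) ⁻¹' Set.Iic t =
      ({ω | Z 0 ω ≤ t} ∩ {ω | Z 1 ω ≤ t}) ∪ (({ω | Z 0 ω ≤ t} ∩ {ω | Z 2 ω ≤ t}) ∪
        ({ω | Z 1 ω ≤ t} ∩ {ω | Z 2 ω ≤ t})) :=
    Set.ext fun ω => middle_le_iff _ t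
  rw [this]
  exact ((h 0).inter (h 1)).union (((h 0).inter (h 2)).union ((h 1).inter (h 2)))

/-- The value proposed to `v` by its child `i :: v`, relative to the position of `v`. -/
noncomputable def proposal {Ω : Type*} (X : Edge → Ω → ℝ) (m : ℕ) (v : Vertex) (i : Fin 3)
    (ω : Ω) : ℝ :=
  X (v, i) ω + relVote (fun e => X e ω) m (i :: v)

theorem measurable_proposal {Ω : Type*} [MeasurableSpace Ω] {X : Edge → Ω → ℝ} {m : ℕ}
    {v : Vertex} {i : Fin 3} (hX : Measurable (X (v, i)))
    (hr : Measurable fun ω => relVote (fun e => X e ω) m (i :: v)) :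
    Measurable (proposal X m v i) :=
  hX.add hr

/-- The relative vote sees only the increments below v; this locality turns disjointness of branches
into independence. -/
theorem measurable_relVote_edgesBelow {Ω : Type*} (X : Edge → Ω → ℝ) (m : ℕ) (v : Vertex) :
    Measurable[sigmaEdges X (edgesBelow v)] fun ω => relVote (fun e => X e ω) m v := by
  induction m generalizing v with
  | zero => exact measurable_const
  | succ m ih =>
    let _ : MeasurableSpace Ω := sigmaEdges X (edgesBelow v)
    refine measurable_middle (Z := proposal X m v) fun i => measurable_proposal
      (measurable_increment (branch_subset v i (Set.mem_insert _ _)))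
      ((ih (i :: v)).mono (sigmaEdges_mono ?_) le_rfl)
    exact (Set.subset_insert _ _).trans (branch_subset v i)

theorem measurable_proposal_branch {Ω : Type*} (X : Edge → Ω → ℝ) (m : ℕ) (v : Vertex)
    (i : Fin 3) : Measurable[sigmaEdges X (branch v i)] (proposal X m v i) := by
  let _ : MeasurableSpace Ω := sigmaEdges X (branch v i)
  exact measurable_proposal (measurable_increment (Set.mem_insert _ _))
    ((measurable_relVote_edgesBelow X m (i :: v)).mono
      (sigmaEdges_mono (Set.subset_insert _ _)) le_rfl)

/-- The distribution function of the vote `n` generations above the final one, relative to the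
position of the voting vertex. -/
noncomputable def voteCdf (μ : Measure ℝ) : ℕ → ℝ → ℝ
  | 0 => (Set.Ici 0).indicator 1
  | n + 1 => fun x => majority (wave μ n x)

theorem smear_voteCdf (μ : Measure ℝ) (n : ℕ) : smear μ (voteCdf μ n) = wave μ n := by
  cases n <;> rfl

section Law

variable {Ω : Type*} [MeasurableSpace Ω] {P : Measure Ω}

/-- The law of the sum of two independent real random variables, by conditioning on the first. -/
theorem measureReal_add_le_eq_smear [IsProbabilityMeasure P] {Y Z : Ω → ℝ} (hY : Measurable Y)
    (hZ : Measurable Z) (h : IndepFun Y Z P) (t : ℝ) :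
    P.real {ω | Y ω + Z ω ≤ t} = smear (P.map Y) (fun s => P.real {ω | Z ω ≤ s}) t := by
  have hS : MeasurableSet {p : ℝ × ℝ | p.1 + p.2 ≤ t} :=
    measurableSet_le measurable_add measurable_const
  have h1 : P {ω | Y ω + Z ω ≤ t} = ∫⁻ y, P {ω | Z ω ≤ t - y} ∂(P.map Y) := by
    have : {ω | Y ω + Z ω ≤ t} = (fun ω => (Y ω, Z ω)) ⁻¹' {p : ℝ × ℝ | p.1 + p.2 ≤ t} := rfl
    rw [this, ← Measure.map_apply (hY.prodMk hZ) hS,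
      (indepFun_iff_map_prod_eq_prod_map_map hY.aemeasurable hZ.aemeasurable).1 h,
      Measure.prod_apply hS]
    refine lintegral_congr fun y => ?_
    rw [Measure.map_apply hZ (measurable_prodMk_left hS)]
    congr 1
    ext ω
    simp [le_sub_iff_add_le']
  rw [Measure.real, h1, smear]
  refine (integral_toReal ?_ (ae_of_all _ fun y => measure_lt_top _ _)).symm
  have hm : Antitone fun y => P {ω | Z ω ≤ t - y} := fun a b hab =>
    measure_mono fun ω (hω : Z ω ≤ t - b) => hω.trans (by linarith)
  exact hm.measurable.aemeasurable

/-- Inclusion-exclusion: any two distinct pairwise intersections meet in the triple one, which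
leaves `3p^2 - 2p^3`. -/
theorem measureReal_two_of_three [IsFiniteMeasure P] {A : Fin 3 → Set Ω} {p : ℝ}
    (hA : ∀ i, MeasurableSet (A i)) (hp : ∀ i, P.real (A i) = p)
    (h2 : ∀ i j, i ≠ j → P.real (A i ∩ A j) = P.real (A i) * P.real (A j))
    (h3 : P.real (A 0 ∩ (A 1 ∩ A 2)) = P.real (A 0) * P.real (A 1 ∩ A 2)) :
    P.real ((A 0 ∩ A 1) ∪ ((A 0 ∩ A 2) ∪ (A 1 ∩ A 2))) = majority p := by
  have e1 := measureReal_union_add_inter (μ := P) (s := A 0 ∩ A 1)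
    (((hA 0).inter (hA 2)).union ((hA 1).inter (hA 2)))
  have e2 := measureReal_union_add_inter (μ := P) (s := A 0 ∩ A 2) ((hA 1).inter (hA 2))
  have i1 : (A 0 ∩ A 1) ∩ ((A 0 ∩ A 2) ∪ (A 1 ∩ A 2)) = A 0 ∩ (A 1 ∩ A 2) := by
    ext; simp; tauto
  have i2 : (A 0 ∩ A 2) ∩ (A 1 ∩ A 2) = A 0 ∩ (A 1 ∩ A 2) := by
    ext; simp; tauto
  rw [i1, h3, h2 1 2 (by decide), h2 0 1 (by decide)] at e1
  rw [i2, h3, h2 1 2 (by decide), h2 0 2 (by decide)] at e2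
  simp only [hp] at e1 e2
  unfold majority
  linarith

variable {q : ℝ → ℝ} {X : Edge → Ω → ℝ}

theorem sigmaEdges_le (hX : IsIncrementField P q X) (S : Set Edge) :
    sigmaEdges X S ≤ ‹MeasurableSpace Ω› :=
  iSup₂_le fun e _ => (hX.measurable e).comap_le

theorem measurable_relVote (hX : IsIncrementField P q X) (m : ℕ) (v : Vertex) :
    Measurable fun ω => relVote (fun e => X e ω) m v :=
  (measurable_relVote_edgesBelow X m v).mono (sigmaEdges_le hX _) le_rfl

theorem indep_sigmaEdges (hX : IsIncrementField P q X) {S T : Set Edge} (h : Disjoint S T) :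
    Indep (sigmaEdges X S) (sigmaEdges X T) P :=
  indep_iSup_of_disjoint (fun e => (hX.measurable e).comap_le) hX.indep.iIndep h

theorem measureReal_inter_of_disjoint (hX : IsIncrementField P q X) {S T : Set Edge}
    (h : Disjoint S T) {A B : Set Ω} (hA : MeasurableSet[sigmaEdges X S] A)
    (hB : MeasurableSet[sigmaEdges X T] B) : P.real (A ∩ B) = P.real A * P.real B := by
  simp only [Measure.real, (Indep_iff _ _ _).1 (indep_sigmaEdges hX h) A B hA hB,
    ENNReal.toReal_mul]

/-- A proposal is an edge increment plus an independent vote, hence a convolution; the three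
proposals use disjoint branches, hence the majority polynomial. -/
theorem measureReal_relVote_le [IsProbabilityMeasure P] {μ : Measure ℝ}
    (hX : IsIncrementField P q X) (hμ : ∀ e, P.map (X e) = μ) (m : ℕ) (v : Vertex) (t : ℝ) :
    P.real {ω | relVote (fun e => X e ω) m v ≤ t} = voteCdf μ m t := by
  induction m generalizing v t with
  | zero =>
    by_cases ht : 0 ≤ t <;> simp [relVote, voteCdf, ht]
  | succ m ih =>
    have hZm := measurable_proposal_branch X m v
    have hprop : ∀ i, P.real {ω | proposal X m v i ω ≤ t} = wave μ m t := fun i => by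
      have hind : IndepFun (X (v, i)) (fun ω => relVote (fun e => X e ω) m (i :: v)) P := by
        rw [IndepFun_iff_Indep]
        refine indep_of_indep_of_le_left (indep_of_indep_of_le_right (indep_sigmaEdges hX
          (S := {(v, i)}) (T := edgesBelow (i :: v)) ?_) ?_) ?_
        · simpa using notMem_edgesBelow_cons v i i
        · exact (measurable_relVote_edgesBelow X m (i :: v)).comap_le
        · exact (measurable_increment (Set.mem_singleton _)).comap_le
      have := measureReal_add_le_eq_smear (hX.measurable (v, i)) (measurable_relVote hX m (i :: v))
        hind t
      rw [hμ, funext (ih (i :: v)), smear_voteCdf] at this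
      exact this
    have hset : {ω | relVote (fun e => X e ω) (m + 1) v ≤ t} =
        ({ω | proposal X m v 0 ω ≤ t} ∩ {ω | proposal X m v 1 ω ≤ t}) ∪
        (({ω | proposal X m v 0 ω ≤ t} ∩ {ω | proposal X m v 2 ω ≤ t}) ∪
        ({ω | proposal X m v 1 ω ≤ t} ∩ {ω | proposal X m v 2 ω ≤ t})) :=
      Set.ext fun ω => middle_le_iff (fun i => proposal X m v i ω) t
    have hms : ∀ i, MeasurableSet[sigmaEdges X (branch v i)] {ω | proposal X m v i ω ≤ t} :=
      fun i => hZm i measurableSet_Iic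
    rw [hset]
    refine measureReal_two_of_three (A := fun i => {ω | proposal X m v i ω ≤ t})
      (fun i => sigmaEdges_le hX _ _ (hms i)) hprop (fun i j hij =>
        measureReal_inter_of_disjoint hX (disjoint_branch v hij) (hms i) (hms j)) ?_
    -- The triple intersection needs one branch to be independent of the other two jointly.
    refine measureReal_inter_of_disjoint hX (S := branch v 0) (T := branch v 1 ∪ branch v 2)
      (Set.disjoint_union_right.2 ⟨disjoint_branch v (by decide), disjoint_branch v (by decide)⟩)
      (hms 0) ?_
    exact MeasurableSet.inter (sigmaEdges_mono Set.subset_union_left _ (hms 1))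
      (sigmaEdges_mono Set.subset_union_right _ (hms 2))

theorem measurable_M (hX : IsIncrementField P q X) (n : ℕ) : Measurable (M X n) := by
  rw [funext (M_eq X n)]
  exact measurable_relVote hX n []

theorem measureReal_M_succ_le [IsProbabilityMeasure P] {μ : Measure ℝ}
    (hX : IsIncrementField P q X) (hμ : ∀ e, P.map (X e) = μ) (n : ℕ) (t : ℝ) :
    P.real {ω | M X (n + 1) ω ≤ t} = majority (wave μ n t) := by
  simp only [M_eq]
  exact measureReal_relVote_le hX hμ (n + 1) [] t

end Law

/-! ### Tightness -/

theorem isNegInvariant_withDensity {q : ℝ → ℝ} (hs : ∀ y, q (-y) = q y) :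
    (volume.withDensity fun y => ENNReal.ofReal (q y)).IsNegInvariant := by
  refine ⟨Measure.ext fun s hs' => ?_⟩
  rw [Measure.neg, Measure.map_apply measurable_neg hs',
    withDensity_apply _ (measurable_neg hs'), withDensity_apply _ hs',
    ← lintegral_indicator (measurable_neg hs'), ← lintegral_indicator hs',
    ← lintegral_neg_eq_self]
  refine lintegral_congr fun y => ?_
  by_cases hy : y ∈ s <;> simp [Set.indicator, hy, hs]

theorem exists_ae_abs_le_of_hasCompactSupport {q : ℝ → ℝ} (hq : HasCompactSupport q)
    (hm : Measurable q) :
    ∃ R, ∀ᵐ y ∂(volume.withDensity fun y => ENNReal.ofReal (q y)), |y| ≤ R := by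
  obtain ⟨R, hR⟩ := hq.isBounded.exists_norm_le
  refine ⟨R, (ae_withDensity_iff hm.ennreal_ofReal).2 (ae_of_all _ fun y hy => hR y ?_)⟩
  exact subset_tsupport _ fun h0 => hy (by simp [h0])

/-- Reflection makes the upper tail bound equal to the lower one, which gives the factor 2. -/
theorem measure_compl_Icc_le {Ω : Type*} [MeasurableSpace Ω] {P : Measure Ω}
    [IsProbabilityMeasure P] {q : ℝ → ℝ} {X : Edge → Ω → ℝ} (hX : IsIncrementField P q X)
    {μ : Measure ℝ} [IsProbabilityMeasure μ] [μ.IsNegInvariant] [NullSingletonClass μ] {R : ℝ}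
    (hR : ∀ᵐ y ∂μ, |y| ≤ R) (hμ : ∀ e, P.map (X e) = μ) (n : ℕ) (A : ℝ) :
    (P.map (M X (n + 1))).real (Set.Icc (-A) A)ᶜ ≤ 2 * majority (wave μ n (-A)) := by
  rw [Measure.real, Measure.map_apply (measurable_M hX _) measurableSet_Icc.compl]
  change P.real _ ≤ _
  have hsub : M X (n + 1) ⁻¹' (Set.Icc (-A) A)ᶜ ⊆
      {ω | M X (n + 1) ω ≤ -A} ∪ {ω | M X (n + 1) ω ≤ A}ᶜ := fun ω hω => by
    simp only [Set.mem_preimage, Set.mem_compl_iff, Set.mem_Icc, not_and_or, not_le] at hω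
    rcases hω with hω | hω
    · exact Or.inl hω.le
    · exact Or.inr (not_le.2 hω)
  refine (measureReal_mono hsub).trans ((measureReal_union_le _ _).trans ?_)
  rw [probReal_compl_eq_one_sub (measurableSet_le (measurable_M hX _) measurable_const),
    measureReal_M_succ_le hX hμ, measureReal_M_succ_le hX hμ, wave_neg hR n A, majority_one_sub]
  linarith

theorem lowerDensity_Ici_one : lowerDensity (Set.Ici 1) = 1 := by
  refine Tendsto.liminf_eq (tendsto_const_nhds.congr' ?_)
  filter_upwards [eventually_ge_atTop 1] with n hn
  have : Set.Ici 1 ∩ Set.Icc 1 n = Set.Icc 1 n := Set.inter_eq_right.2 Set.Icc_subset_Ici_self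
  rw [this, ← Finset.coe_Icc, Set.ncard_coe_finset, Nat.card_Icc, Nat.add_sub_cancel, div_self]
  exact Nat.cast_ne_zero.2 (by omega)

/-- All the votes but the first form a tight family. -/
theorem isTightMeasureSet_M_succ {Ω : Type*} [MeasurableSpace Ω] {P : Measure Ω}
    [IsProbabilityMeasure P] {q : ℝ → ℝ} (hq : IsJumpDensity q) (hq_symm : ∀ y, q (-y) = q y)
    {X : Edge → Ω → ℝ} (hX : IsIncrementField P q X) :
    IsTightMeasureSet {ν : Measure ℝ | ∃ n ∈ Set.Ici 1, ν = P.map (M X n)} := by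
  have hqm := hq.continuous.measurable
  set μ : Measure ℝ := volume.withDensity fun y => ENNReal.ofReal (q y) with hμ
  have hlaw : ∀ e, P.map (X e) = μ := hX.law
  have hprob : IsProbabilityMeasure μ :=
    hlaw ([], 0) ▸ Measure.isProbabilityMeasure_map (hX.measurable _).aemeasurable
  have hneg : μ.IsNegInvariant := isNegInvariant_withDensity hq_symm
  obtain ⟨R, hR⟩ := exists_ae_abs_le_of_hasCompactSupport hq.hasCompactSupport hqm
  rw [isTightMeasureSet_iff_exists_isCompact_measure_compl_le]
  intro ε hε
  -- The cap 1/2 is what allows `majority_le`, so that the two tails total at most 2δ.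
  obtain ⟨δ, hδ0, hδ1, hδ⟩ : ∃ δ : ℝ, 0 < δ ∧ δ ≤ 1 / 2 ∧ ENNReal.ofReal (2 * δ) ≤ ε := by
    rcases eq_or_ne ε ⊤ with rfl | hε'
    · exact ⟨1 / 2, by norm_num, le_rfl, le_top⟩
    · have hpos := ENNReal.toReal_pos hε.ne' hε'
      refine ⟨min (1 / 2) (ε.toReal / 2), by positivity, min_le_left _ _, ?_⟩
      refine (ENNReal.ofReal_le_ofReal ?_).trans_eq (ENNReal.ofReal_toReal hε')
      linarith [min_le_right (1 / 2) (ε.toReal / 2)]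
  obtain ⟨A, hA0, hA⟩ : ∃ A : ℝ, 0 ≤ A ∧ energy μ 0 < A * (δ ^ 3 / 2) := by
    -- The tail bound at A = 0.
    have hE : 0 ≤ energy μ 0 := by simpa using mul_wave_pow_le hR 0 le_rfl
    refine ⟨(energy μ 0 + 1) / (δ ^ 3 / 2), by positivity, ?_⟩
    rw [div_mul_cancel₀ _ (by positivity)]
    linarith
  refine ⟨Set.Icc (-A) A, isCompact_Icc, ?_⟩
  rintro ν ⟨n, hn, rfl⟩
  obtain ⟨n, rfl⟩ := Nat.exists_eq_succ_of_ne_zero (Nat.one_le_iff_ne_zero.1 hn)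
  have hwδ : wave μ n (-A) ≤ δ := by
    by_contra! hlt
    have h1 := mul_wave_pow_le hR n hA0
    have h2 := mul_le_mul_of_nonneg_left (pow_le_pow_left₀ hδ0.le hlt.le 3) hA0
    linarith
  have hw0 := (wave_mem_Icc (μ := μ) hR n (-A)).1
  have hle := measure_compl_Icc_le hX hR hlaw n A
  have : IsProbabilityMeasure (P.map (M X (n + 1))) :=
    Measure.isProbabilityMeasure_map (measurable_M hX _).aemeasurable
  rw [Nat.succ_eq_add_one, ← ofReal_measureReal]
  refine (ENNReal.ofReal_le_ofReal ?_).trans hδ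
  linarith [majority_le hw0 (hwδ.trans hδ1)]

end TernaryVoting

theorem theorem3p4 {Ω : Type*} [MeasurableSpace Ω] (P : Measure Ω) [IsProbabilityMeasure P]
    (q : ℝ → ℝ) (hq : TernaryVoting.IsJumpDensity q) (hq_symm : ∀ y, q (-y) = q y)
    (X : TernaryVoting.Edge → Ω → ℝ) (hX : TernaryVoting.IsIncrementField P q X) :
    ∃ I : Set ℕ,
      IsTightMeasureSet {ν : Measure ℝ | ∃ n ∈ I, ν = P.map (TernaryVoting.M X n)} ∧
      0 < TernaryVoting.lowerDensity I := by
  -- Index 0 is left out because the formula through `wave` starts at `M 1`; the density is still 1.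
  refine ⟨Set.Ici 1, TernaryVoting.isTightMeasureSet_M_succ hq hq_symm hX, ?_⟩
  rw [TernaryVoting.lowerDensity_Ici_one]
  exact one_pos
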